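/- Let $\mathbb{K}=\mathbb{R}$ or $\mathbb{C}$, let $\Omega$ be a non-empty topological Hausdorff space, let $\mathcal{F}$ be a linear space of continuous functions $\Omega\to\mathbb{K}$ and let $\tau$ be a bornological locally convex Hausdorff topology on $\mathcal{F}$. Denote by $\mathcal{B}$ the family of $\tau$-bounded sets, by $\tau_{\mathrm{p}}$ the topology of pointwise convergence on $\mathcal{F}$, by $\tau_{\mathrm{co}}$ the topology on $\mathcal{F}$ of uniform convergence on compact subsets of $\Omega$, and put $\delta_x(f):=f(x)$ for $x\in\Omega$ and $f\in\mathcal{F}$. For topologies, $\sigma\le\sigma'$ means that $\sigma$ is coarser than $\sigma'$. A *continuous strong complete barrelled linearisation* of $(\mathcal{F},\tau)$ is a triple $(\delta,Y,T)$ of a complete barrelled locally convex Hausdorff space $Y$ over $\mathbb{K}$, a continuous map $\delta\colon\Omega\to Y$ and a topological isomorphism $T$ from $(\mathcal{F},\tau)$ onto the strong dual $Y_b'$ such that $T(f)\circ\delta=f$ for all $f\in\mathcal{F}$. For a locally convex Hausdorff topology $\widetilde\tau$ on $\mathcal{F}$, $(\mathcal{F},\tau)$ satisfies $(\mathrm{BBC})$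 for $\widetilde\tau$ if every $\tau$-bounded set is contained in an absolutely convex $\tau$-bounded $\widetilde\tau$-compact set, and $(\mathrm{CNC})$ for $\widetilde\tau$ if $\tau$ has a $0$-neighbourhood basis of absolutely convex $\widetilde\tau$-closed sets. Let $\mathcal{F}'_{\mathcal{B},\widetilde\tau}$ be the space of all linear functionals on $\mathcal{F}$ whose restriction to each $B\in\mathcal{B}$ is $\widetilde\tau$-continuous, equipped with the topology $\beta$ of uniform convergence on the sets $B\in\mathcal{B}$. Consider the following assertions. (a) $(\mathcal{F},\tau)$ admits a continuous strong complete barrelled linearisation. (b) $(\mathcal{F},\tau)$ satisfies $(\mathrm{BBC})$ and $(\mathrm{CNC})$ for some locally convex Hausdorff topology $\widetilde\tau$ on $\mathcal{F}$ with $\tau_{\mathrm{p}}\le\widetilde\tau$, and every $B\in\mathcal{B}$ is equicontinuous. (c) $(\mathcal{F},\tau)$ satisfies $(\mathrm{BBC})$ and $(\mathrm{CNC})$ for some locally convex Hausdorff topology $\widetilde\tau$ on $\mathcal{F}$ such that $\delta_x\in\mathcal{F}'_{\mathcal{B},\widetilde\tau}$ for all $x\in\Omega$ and the map $\Delta\colon\Omega\to(\mathcal{F}'_{\mathcal{B},\widetilde\tau},\beta)$,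 $\Delta(x):=\delta_x$, is continuous. (d) $(\mathcal{F},\tau)$ satisfies $(\mathrm{BBC})$ and $(\mathrm{CNC})$ for some locally convex Hausdorff topology $\widetilde\tau$ on $\mathcal{F}$ with $\tau_{\mathrm{co}}\le\widetilde\tau$. Then (a)$\Leftrightarrow$(b)$\Leftrightarrow$(c). If $\Omega$ is a $gk_{\mathbb{R}}$-space, that is, if every map from $\Omega$ to a completely regular space whose restriction to each compact subset of $\Omega$ is continuous is itself continuous, then (d)$\Rightarrow$(c). -/

import Mathlib

open scoped ComplexOrder

universe u v w w'

/-! Topologies on a vector space are passed as explicit arguments, since several of them live on the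
same space. The order `t₁ ≤ t₂` on `TopologicalSpace X` means that `t₁` is finer than `t₂`. -/

section Spaces

variable (𝕜 : Type v) [RCLike 𝕜] {X : Type u} [AddCommGroup X] [Module 𝕜 X]

/-- `τ` is a locally convex Hausdorff (vector space) topology on `X`. -/
structure IsLocallyConvexHausdorff (τ : TopologicalSpace X) : Prop where
  isTopologicalAddGroup : @IsTopologicalAddGroup X τ _
  continuousSMul : @ContinuousSMul 𝕜 X _ _ τ
  locallyConvexSpace : @LocallyConvexSpace 𝕜 X _ _ _ _ τ
  t2Space : @T2Space X τ

/-- `B` is a `τ`-bounded subset of `X`. -/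
abbrev IsBoundedFor (τ : TopologicalSpace X) (B : Set X) : Prop :=
  @Bornology.IsVonNBounded 𝕜 X _ _ _ τ B

/-- The topology `τ` is bornological: every absolutely convex set that absorbs all `τ`-bounded sets
is a `τ`-neighbourhood of `0`. -/
def IsBornological (τ : TopologicalSpace X) : Prop :=
  ∀ U : Set X, AbsConvex 𝕜 U → (∀ B : Set X, IsBoundedFor 𝕜 τ B → Absorbs 𝕜 U B) →
    U ∈ @nhds X τ 0

/-- Condition (BBC) of `(X, τ)` for `τ'`: every `τ`-bounded set is contained in an absolutely convex
`τ`-bounded `τ'`-compact set. -/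
def SatisfiesBBC (τ τ' : TopologicalSpace X) : Prop :=
  ∀ B : Set X, IsBoundedFor 𝕜 τ B →
    ∃ K : Set X, B ⊆ K ∧ AbsConvex 𝕜 K ∧ IsBoundedFor 𝕜 τ K ∧ @IsCompact X τ' K

/-- Condition (CNC) of `(X, τ)` for `τ'`: `τ` has a `0`-neighbourhood basis of absolutely convex
`τ'`-closed sets. -/
def SatisfiesCNC (τ τ' : TopologicalSpace X) : Prop :=
  (@nhds X τ 0).HasBasis
    (fun U : Set X => U ∈ @nhds X τ 0 ∧ AbsConvex 𝕜 U ∧ @IsClosed X τ' U) id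

/-- The space of all linear functionals on `X` whose restriction to every `τ`-bounded set is
`τ'`-continuous. -/
def boundedlyContinuousDual (τ τ' : TopologicalSpace X) : Submodule 𝕜 (Module.Dual 𝕜 X) where
  carrier := {φ | ∀ B : Set X, IsBoundedFor 𝕜 τ B → @ContinuousOn X 𝕜 τ' _ φ B}
  zero_mem' := fun _ _ => @continuousOn_const X 𝕜 τ' _ _ _
  add_mem' := fun hφ hψ B hB => by
    let _ := τ'
    exact (hφ B hB).add (hψ B hB)
  smul_mem' := fun c _ hφ B hB => by
    let _ := τ'
    exact (hφ B hB).const_smul c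

/-- The topology `β` on `boundedlyContinuousDual 𝕜 τ τ'` of uniform convergence on the `τ`-bounded
subsets of `X`. -/
@[reducible]
def boundedlyContinuousDualTopology (τ τ' : TopologicalSpace X) :
    TopologicalSpace (boundedlyContinuousDual 𝕜 τ τ') :=
  TopologicalSpace.induced
    (fun φ => UniformOnFun.ofFun {B : Set X | IsBoundedFor 𝕜 τ B} (φ.1 : X → 𝕜)) inferInstance

end Spaces

section FunctionSpaces

variable {𝕜 : Type v} [RCLike 𝕜] {Ω : Type u}

/-- The topology `τ_p` of pointwise convergence on `F`. -/
@[reducible]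
def pointwiseTopology (F : Submodule 𝕜 (Ω → 𝕜)) : TopologicalSpace F :=
  TopologicalSpace.induced (fun f : F => (f.1 : Ω → 𝕜)) Pi.topologicalSpace

/-- The topology `τ_co` on `F` of uniform convergence on the compact subsets of `Ω`. -/
@[reducible]
def compactOpenTopology [TopologicalSpace Ω] (F : Submodule 𝕜 (Ω → 𝕜)) : TopologicalSpace F :=
  TopologicalSpace.induced
    (fun f : F => UniformOnFun.ofFun {K : Set Ω | IsCompact K} (f.1 : Ω → 𝕜)) inferInstance

/-- The point evaluation `δ_x : F → 𝕜`, `δ_x f = f x`. -/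
def pointEvaluation (F : Submodule 𝕜 (Ω → 𝕜)) (x : Ω) : Module.Dual 𝕜 F :=
  (LinearMap.proj x).comp F.subtype

/-- `(δ, Y, T)` is a strong linearisation of `(F, τ)`: `T` is a topological isomorphism from `(F, τ)`
onto the strong dual of `Y` (Mathlib's topology on `StrongDual 𝕜 Y` is that of uniform convergence
on bounded sets) with `T f ∘ δ = f` for all `f` in `F`. -/
structure IsStrongLinearisation (F : Submodule 𝕜 (Ω → 𝕜)) (τ : TopologicalSpace F)
    {Y : Type w} [AddCommGroup Y] [Module 𝕜 Y] [TopologicalSpace Y]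
    (δ : Ω → Y) (T : F ≃ₗ[𝕜] StrongDual 𝕜 Y) : Prop where
  isHomeomorph : @IsHomeomorph F (StrongDual 𝕜 Y) τ _ T
  comp_eq : ∀ f : F, (fun x : Ω => T f (δ x)) = f.1

/-- `(F, τ)` admits a continuous strong complete barrelled linearisation. The uniform structure of
`Y` is the one determined by its vector space topology. -/
def AdmitsContinuousStrongCompleteBarrelledLinearisation [TopologicalSpace Ω]
    (F : Submodule 𝕜 (Ω → 𝕜)) (τ : TopologicalSpace F) : Prop :=
  ∃ (Y : Type (max u v w)) (_ : AddCommGroup Y) (_ : Module 𝕜 Y) (_ : UniformSpace Y)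
    (_ : IsUniformAddGroup Y) (_ : ContinuousSMul 𝕜 Y) (_ : LocallyConvexSpace 𝕜 Y) (_ : T2Space Y)
    (δ : Ω → Y) (T : F ≃ₗ[𝕜] StrongDual 𝕜 Y),
    CompleteSpace Y ∧ BarrelledSpace 𝕜 Y ∧ IsStrongLinearisation F τ δ T ∧ Continuous δ

end FunctionSpaces

/-- `Ω` is a `gk_ℝ`-space: every map from `Ω` to a completely regular space whose restriction to each
compact subset is continuous is continuous. -/
def IsGkRSpace (Ω : Type u) [TopologicalSpace Ω] : Prop :=
  ∀ (Z : Type w') [TopologicalSpace Z] [CompletelyRegularSpace Z] (f : Ω → Z),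
    (∀ K : Set Ω, IsCompact K → ContinuousOn f K) → Continuous f

open Topology Filter Bornology
open scoped Pointwise

/-! ### Polars and separation by linear functionals. -/

section Polars

variable {𝕜 : Type*} [RCLike 𝕜] {E : Type*} [AddCommGroup E] [Module 𝕜 E]

/-! For (c) ⇒ (a), take as predual `Y` the functionals that are `τ'`-continuous on bounded sets,
with the topology `β`; `δ` is point evaluation and `T` is `IsBoundedlyContinuousDual.evalDual`.
Hahn–Banach for `τ'` makes `T` injective, and (BBC) makes it onto by the Mackey–Arens argument.
Bornologicity makes `T` continuous; (CNC) and the bipolar theorem make its inverse continuous.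
Completeness holds since linearity and continuity on bounded sets survive uniform limits. The
deepest point is `barrelledSpace`: polars of (CNC) neighbourhoods are Banach discs in `Y`, a lower
semicontinuous seminorm is bounded on each of them, and therefore the polar of its unit ball is
`τ`-bounded.

Conversely, a linearisation transports the weak-* topology of `Y'` to `F`. Polars of bounded subsets
of `Y` give (CNC); Banach–Steinhaus and Banach–Alaoglu give (BBC). Bounded sets are equicontinuous
on `Y`, and composing with the continuous `δ` makes them equicontinuous on `Ω`. This equicontinuity
amounts to continuity of `x ↦ δ_x` for `β`, which links (b) to (c).

For (d) ⇒ (c), the function `x ↦ sup_{f ∈ K} |f(x₀) - f(x)|` is continuous on compact sets when `K`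
is compact, hence continuous on a `gk_ℝ`-space, and it vanishes at `x₀`. -/

theorem convex_of_convex_real [Module ℝ E] [IsScalarTower ℝ 𝕜 E] {s : Set E} (hs : Convex ℝ s) :
    Convex 𝕜 s := by
  refine convex_of_nonneg_surjective_algebraMap 𝕜 (fun a ha => ?_) hs
  rw [Set.mem_Ici, RCLike.nonneg_iff] at ha
  exact ⟨RCLike.re a, ha.1, RCLike.conj_eq_iff_re.1 (RCLike.conj_eq_iff_im.2 ha.2)⟩

theorem locallyConvexSpace_rclike : LocallyConvexSpace 𝕜 𝕜 :=
  LocallyConvexSpace.ofBasisZero 𝕜 𝕜 _ _ Metric.nhds_basis_closedBall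
    fun _ _ => convex_of_convex_real (convex_closedBall _ _)

/-- The polar of a family of linear functionals is absolutely convex. -/
theorem absConvex_setOf_norm_le_one {ι : Type*} (φ : ι → Module.Dual 𝕜 E) (S : Set ι) :
    AbsConvex 𝕜 {x | ∀ i ∈ S, ‖φ i x‖ ≤ 1} := by
  refine ⟨balanced_iff_smul_mem.2 fun {c} hc x hx i hi => ?_, fun x hx y hy a b ha hb hab i hi => ?_⟩
  · rw [map_smul, norm_smul]
    exact mul_le_one₀ hc (norm_nonneg _) (hx i hi)
  · have h : Convex 𝕜 (Metric.closedBall (0 : 𝕜) 1) :=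
      convex_of_convex_real (convex_closedBall _ _)
    have := h (mem_closedBall_zero_iff.2 (hx i hi)) (mem_closedBall_zero_iff.2 (hy i hi)) ha hb hab
    rw [mem_closedBall_zero_iff] at this
    simpa using this

/-- The polar of a family of linear functionals absorbs a set if and only if the family is uniformly
bounded on it. -/
theorem absorbs_setOf_norm_le_one_iff {ι : Type*} (φ : ι → Module.Dual 𝕜 E) (S : Set ι)
    (B : Set E) :
    Absorbs 𝕜 {x | ∀ i ∈ S, ‖φ i x‖ ≤ 1} B ↔ ∃ C : ℝ, ∀ x ∈ B, ∀ i ∈ S, ‖φ i x‖ ≤ C := by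
  rw [absorbs_iff_eventually_cobounded_mapsTo]
  constructor
  · intro h
    obtain ⟨c, hc, hc1⟩ := (h.and (eventually_cobounded_le_norm (1 : ℝ))).exists
    refine ⟨‖c‖, fun x hx i hi => ?_⟩
    have := hc hx i hi
    rw [map_smul, norm_smul, norm_inv] at this
    rwa [inv_mul_le_one₀ (by linarith)] at this
  · rintro ⟨C, hC⟩
    filter_upwards [eventually_cobounded_le_norm (max C 1)] with c hc x hx i hi
    have h1 : 0 < ‖c‖ := by linarith [le_max_right C 1]
    rw [map_smul, norm_smul, norm_inv, inv_mul_le_one₀ h1]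
    exact (hC x hx i hi).trans ((le_max_left C 1).trans hc)

/-- A point outside a closed absolutely convex set is separated from it by a continuous linear
functional. -/
theorem AbsConvex.exists_strongDual_norm_le_one [TopologicalSpace E] [IsTopologicalAddGroup E]
    [ContinuousSMul 𝕜 E] [LocallyConvexSpace 𝕜 E] {s : Set E} (hs : AbsConvex 𝕜 s)
    (hc : IsClosed s) (hne : s.Nonempty) {x : E} (hx : x ∉ s) :
    ∃ f : StrongDual 𝕜 E, (∀ a ∈ s, ‖f a‖ ≤ 1) ∧ 1 < ‖f x‖ := by
  let : Module ℝ E := Module.compHom E (algebraMap ℝ 𝕜)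
  have : IsScalarTower ℝ 𝕜 E :=
    ⟨fun r c y => by
      change (r • c) • y = (algebraMap ℝ 𝕜 r) • c • y
      rw [Algebra.smul_def, mul_smul]⟩
  have : LocallyConvexSpace ℝ E := by
    refine LocallyConvexSpace.ofBasisZero ℝ E _ _ (LocallyConvexSpace.convex_basis_zero 𝕜 E) ?_
    exact fun i hi => hi.2.lift ℝ
  obtain ⟨f, u, hu, hux⟩ :=
    RCLike.geometric_hahn_banach_closed_point (𝕜 := 𝕜) (hs.2.lift ℝ) hc hx
  have h0 : 0 < u := by simpa using hu 0 (hs.1.zero_mem hne)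
  have hnorm : ∀ a ∈ s, ‖f a‖ ≤ u := fun a ha => by
    -- Rotating `a` inside the balanced set `s` turns the bound on the real part into a bound on the
    -- modulus.
    obtain ⟨c, hc1, hc2⟩ := RCLike.exists_norm_eq_mul_self (f a)
    have h1 := hu (c • a) (hs.1.smul_mem hc1.le ha)
    rw [map_smul, smul_eq_mul, ← hc2, RCLike.ofReal_re] at h1
    exact h1.le
  have hun : ‖((u⁻¹ : ℝ) : 𝕜)‖ = u⁻¹ := by
    rw [RCLike.norm_ofReal, abs_of_pos (inv_pos.2 h0)]
  refine ⟨((u⁻¹ : ℝ) : 𝕜) • f, fun a ha => ?_, ?_⟩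
  · rw [smul_apply, norm_smul, hun, inv_mul_le_one₀ h0]
    exact hnorm a ha
  · rw [smul_apply, norm_smul, hun, ← div_eq_inv_mul, one_lt_div h0]
    exact hux.trans_le (RCLike.re_le_norm _)

theorem Seminorm.absConvex_setOf_le (p : Seminorm 𝕜 E) (r : ℝ) : AbsConvex 𝕜 {x | p x ≤ r} := by
  have hball := p.balanced_closedBall_zero r
  rw [Seminorm.closedBall_zero_eq] at hball
  refine ⟨hball, fun x hx y hy a b ha hb hab => ?_⟩
  have hab' : ‖a‖ + ‖b‖ = 1 := by
    have h : ((‖a‖ + ‖b‖ : ℝ) : 𝕜) = ((1 : ℝ) : 𝕜) := by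
      rw [RCLike.ofReal_add, RCLike.norm_of_nonneg' ha, RCLike.norm_of_nonneg' hb, hab,
        RCLike.ofReal_one]
    exact RCLike.ofReal_injective h
  calc p (a • x + b • y) ≤ ‖a‖ * p x + ‖b‖ * p y :=
        (map_add_le_add p _ _).trans_eq (by rw [map_smul_eq_mul, map_smul_eq_mul])
    _ ≤ ‖a‖ * r + ‖b‖ * r :=
        add_le_add (mul_le_mul_of_nonneg_left hx (norm_nonneg a))
          (mul_le_mul_of_nonneg_left hy (norm_nonneg b))
    _ = r := by rw [← add_mul, hab', one_mul]

/-- An absolutely convex weakly compact set is equal to its bipolar. -/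
theorem WeakBilin.mem_of_isCompact_of_absConvex {W Z : Type*} [AddCommGroup W] [Module 𝕜 W]
    [AddCommGroup Z] [Module 𝕜 Z] (P : W →ₗ[𝕜] Z →ₗ[𝕜] 𝕜) (hP : Function.Injective P)
    {S : Set (WeakBilin P)} (hS : IsCompact S) (hSa : AbsConvex 𝕜 S) (hne : S.Nonempty)
    {ψ : WeakBilin P}
    (hψ : ∀ z, (∀ g ∈ S, ‖WeakBilin.eval P z g‖ ≤ 1) → ‖WeakBilin.eval P z ψ‖ ≤ 1) : ψ ∈ S := by
  let w : WeakBilin P →ₗ[𝕜] Z → 𝕜 :=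
    { toFun := fun f z => P f z
      map_add' := fun f g => funext fun z => LinearMap.map_add₂ P f g z
      map_smul' := fun c f => funext fun z => LinearMap.map_smul₂ P c f z }
  have hw : IsEmbedding w := WeakBilin.isEmbedding hP
  have := locallyConvexSpace_rclike (𝕜 := 𝕜)
  have : LocallyConvexSpace 𝕜 (WeakBilin P) := hw.isInducing.locallyConvexSpace
  have := hw.t2Space
  by_contra hmem
  obtain ⟨f, hf, hfψ⟩ := hSa.exists_strongDual_norm_le_one hS.isClosed hne hmem
  -- The weakly continuous functionals are exactly the evaluations at points of `Z`.
  obtain ⟨z, rfl⟩ := LinearMap.dualEmbedding_surjective P f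
  exact hfψ.not_ge (hψ z hf)

end Polars

/-! ### Banach discs and lower semicontinuous seminorms. -/

section BanachDisks

variable {𝕜 : Type*} [RCLike 𝕜] {E : Type*} [AddCommGroup E] [Module 𝕜 E] [UniformSpace E]
  [IsUniformAddGroup E] [CompleteSpace E]

set_option synthInstance.maxHeartbeats 200000 in
set_option maxHeartbeats 1000000 in
/-- A lower semicontinuous seminorm on a complete space is bounded on every bounded set which is the
polar of a separating family of continuous linear functionals. -/
theorem Seminorm.exists_forall_le_of_lowerSemicontinuous {ι : Type*} (φ : ι → StrongDual 𝕜 E)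
    (hφ : ∀ x, (∀ i, φ i x = 0) → x = 0) (hb : IsVonNBounded 𝕜 {x | ∀ i, ‖φ i x‖ ≤ 1})
    (p : Seminorm 𝕜 E) (hp : LowerSemicontinuous p) :
    ∃ C : ℝ, 0 < C ∧ ∀ x, (∀ i, ‖φ i x‖ ≤ 1) → p x ≤ C := by
  classical
  -- The span of the disc, normed by its gauge, is realised through `x ↦ (φ i x)` as a subspace `G`
  -- of `ℓ^∞`; `J` is the inverse map.
  obtain ⟨G, hG⟩ : ∃ G : Submodule 𝕜 (lp (fun _ : ι => 𝕜) ⊤), ∀ g, g ∈ G ↔ ∃ x, ∀ i, φ i x = g i :=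
    ⟨{carrier := {g | ∃ x, ∀ i, φ i x = g i}
      zero_mem' := ⟨0, fun i => by simp⟩
      add_mem' := by
        rintro g h ⟨x, hx⟩ ⟨y, hy⟩
        exact ⟨x + y, fun i => by simp [hx, hy]⟩
      smul_mem' := by
        rintro c g ⟨x, hx⟩
        exact ⟨c • x, fun i => by simp [hx]⟩}, fun g => Iff.rfl⟩
  have hex : ∀ g : G, ∃ x, ∀ i, φ i x = g.1 i := fun g => (hG g.1).1 g.2
  choose j hj using hex
  have huniq : ∀ x y, (∀ i, φ i x = φ i y) → x = y := fun x y h =>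
    sub_eq_zero.1 (hφ _ fun i => by rw [map_sub, h i, sub_self])
  let J : G →ₗ[𝕜] E :=
    { toFun := j
      map_add' := fun g h => huniq _ _ fun i => by simp [hj]
      map_smul' := fun c g => huniq _ _ fun i => by simp [hj] }
  have hJ : ∀ g i, φ i (J g) = g.1 i := hj
  have hball : IsVonNBounded 𝕜 (J '' Metric.closedBall 0 1) := by
    refine hb.subset ?_
    rintro _ ⟨g, hg, rfl⟩ i
    rw [hJ]
    exact (lp.norm_apply_le_norm ENNReal.top_ne_zero g.1 i).trans (mem_closedBall_zero_iff.1 hg)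
  let JL : G →L[𝕜] E :=
    J.clmOfExistsBoundedImage ⟨_, Metric.closedBall_mem_nhds 0 one_pos, hball⟩
  have hJL : ∀ g i, φ i (JL g) = g.1 i := hj
  -- A Cauchy sequence converges in `ℓ^∞` and, through `JL`, also in `E`. Comparing coordinates
  -- shows that the `ℓ^∞` limit comes from the limit in `E`.
  have : CompleteSpace G := by
    refine Metric.complete_of_cauchySeq_tendsto fun u hu => ?_
    obtain ⟨x, hx⟩ := cauchySeq_tendsto_of_complete (JL.uniformContinuous.comp_cauchySeq hu)
    have hu' : CauchySeq fun n => (u n).1 := uniformContinuous_subtype_val.comp_cauchySeq hu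
    obtain ⟨g, hg⟩ := cauchySeq_tendsto_of_complete hu'
    have hgx : ∀ i, φ i x = g i := fun i => by
      have h1 : Tendsto (fun n => (u n).1 i) atTop (𝓝 (φ i x)) := by
        have := ((φ i).continuous.tendsto x).comp hx
        refine this.congr fun n => hJL (u n) i
      have h2 : Tendsto (fun n => (u n).1 i) atTop (𝓝 (g i)) := by
        rw [tendsto_iff_norm_sub_tendsto_zero] at hg ⊢
        refine squeeze_zero (fun _ => norm_nonneg _) (fun n => ?_) hg
        exact lp.norm_apply_le_norm ENNReal.top_ne_zero ((u n).1 - g) i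
      exact tendsto_nhds_unique h1 h2
    exact ⟨⟨g, (hG g).2 ⟨x, hgx⟩⟩, tendsto_subtype_rng.2 hg⟩
  -- The Banach space `G` is barrelled.
  have hcont : Continuous (p.comp (JL : G →ₗ[𝕜] E)) :=
    Seminorm.continuous_of_lowerSemicontinuous _ (hp.comp JL.continuous)
  obtain ⟨C, hC0, hC⟩ := Seminorm.bound_of_continuous_normedSpace _ hcont
  refine ⟨C, hC0, fun x hx => ?_⟩
  have hmem : Memℓp (fun i => φ i x) (⊤ : ENNReal) :=
    memℓp_infty ⟨1, by rintro _ ⟨i, rfl⟩; exact hx i⟩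
  let g : G := ⟨⟨fun i => φ i x, hmem⟩, (hG _).2 ⟨x, fun i => rfl⟩⟩
  have hgx : JL g = x := huniq _ _ fun i => hJL g i
  have hg1 : ‖g‖ ≤ 1 := lp.norm_le_of_forall_le zero_le_one hx
  have h := hC g
  rw [Seminorm.comp_apply] at h
  have h' : p x ≤ C * ‖g‖ := by
    rw [← hgx]
    exact h
  nlinarith

end BanachDisks
-- The predual: functionals continuous on bounded sets.
section BoundedSets

variable {𝕜 : Type*} [RCLike 𝕜] {X : Type*} [AddCommGroup X] [Module 𝕜 X]
  {τ : TopologicalSpace X}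

theorem IsLocallyConvexHausdorff.isBoundedFor_smul (hτ : IsLocallyConvexHausdorff 𝕜 τ) {B : Set X}
    (hB : IsBoundedFor 𝕜 τ B) (c : 𝕜) : IsBoundedFor 𝕜 τ (c • B) := by
  have := hτ.continuousSMul
  exact hB.image (c • ContinuousLinearMap.id 𝕜 X)

theorem IsLocallyConvexHausdorff.isBoundedFor_singleton (hτ : IsLocallyConvexHausdorff 𝕜 τ)
    (x : X) : IsBoundedFor 𝕜 τ {x} := by
  have := hτ.continuousSMul
  exact isVonNBounded_singleton x

end BoundedSets

/-- `Z`, paired with `X` by `b`, is a copy of `boundedlyContinuousDual 𝕜 τ τ'` with the uniform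
structure of uniform convergence on the `τ`-bounded sets. -/
structure IsBoundedlyContinuousDual (𝕜 : Type*) [RCLike 𝕜] {X Z : Type*} [AddCommGroup X]
    [Module 𝕜 X] [AddCommGroup Z] [Module 𝕜 Z] [UniformSpace Z] (τ τ' : TopologicalSpace X)
    (b : Z →ₗ[𝕜] Module.Dual 𝕜 X) : Prop where
  injective : Function.Injective b
  mem_range_iff : ∀ φ, φ ∈ Set.range b ↔ φ ∈ boundedlyContinuousDual 𝕜 τ τ'
  isUniformInducing : IsUniformInducing fun z =>
    UniformOnFun.ofFun {B : Set X | IsBoundedFor 𝕜 τ B} (b z : X → 𝕜)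

theorem isBoundedlyContinuousDual_of_linearEquiv {𝕜 X Z : Type*} [RCLike 𝕜] [AddCommGroup X]
    [Module 𝕜 X] [AddCommGroup Z] [Module 𝕜 Z] [UniformSpace Z] {τ τ' : TopologicalSpace X}
    (e : Z ≃ₗ[𝕜] boundedlyContinuousDual 𝕜 τ τ')
    (he : IsUniformInducing fun z =>
      UniformOnFun.ofFun {B : Set X | IsBoundedFor 𝕜 τ B} ((e z).1 : X → 𝕜)) :
    IsBoundedlyContinuousDual 𝕜 τ τ' ((boundedlyContinuousDual 𝕜 τ τ').subtype.comp e.toLinearMap) where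
  injective := Subtype.val_injective.comp e.injective
  mem_range_iff φ := by
    refine ⟨?_, fun hφ => ⟨e.symm ⟨φ, hφ⟩, ?_⟩⟩
    · rintro ⟨z, rfl⟩
      exact (e z).2
    · exact congrArg Subtype.val (e.apply_symm_apply ⟨φ, hφ⟩)
  isUniformInducing := he

namespace IsBoundedlyContinuousDual

variable {𝕜 : Type*} [RCLike 𝕜] {X Z : Type*} [AddCommGroup X] [Module 𝕜 X] [AddCommGroup Z]
  [Module 𝕜 Z] [UniformSpace Z] {τ τ' : TopologicalSpace X} {b : Z →ₗ[𝕜] Module.Dual 𝕜 X}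

theorem continuousOn (h : IsBoundedlyContinuousDual 𝕜 τ τ' b) (z : Z) {B : Set X}
    (hB : IsBoundedFor 𝕜 τ B) : @ContinuousOn X 𝕜 τ' _ (b z) B :=
  (h.mem_range_iff _).1 ⟨z, rfl⟩ B hB

theorem exists_eq_of_continuous (h : IsBoundedlyContinuousDual 𝕜 τ τ' b) (φ : Module.Dual 𝕜 X)
    (hφ : @Continuous X 𝕜 τ' _ φ) : ∃ z, b z = φ :=
  (h.mem_range_iff φ).2 fun _ _ => @Continuous.continuousOn X 𝕜 τ' _ _ _ hφ

/-- (BBC) encloses `B` in a compact set on which the functional is continuous. This bound is what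
makes scalar multiplication on `Z` continuous. -/
theorem exists_norm_le (h : IsBoundedlyContinuousDual 𝕜 τ τ' b) (hBBC : SatisfiesBBC 𝕜 τ τ')
    {B : Set X} (hB : IsBoundedFor 𝕜 τ B) (z : Z) : ∃ C : ℝ, ∀ x ∈ B, ‖b z x‖ ≤ C := by
  obtain ⟨K, hBK, -, hKb, hKc⟩ := hBBC B hB
  let _ := τ'
  obtain ⟨C, hC⟩ := hKc.exists_bound_of_continuousOn (h.continuousOn z hKb)
  exact ⟨C, fun x hx => hC x (hBK hx)⟩

theorem isUniformAddGroup (h : IsBoundedlyContinuousDual 𝕜 τ τ' b) : IsUniformAddGroup Z :=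
  IsUniformInducing.isUniformAddGroup
    ({ toFun := fun z => UniformOnFun.ofFun {B : Set X | IsBoundedFor 𝕜 τ B} (b z : X → 𝕜)
       map_zero' := by rw [map_zero]; rfl
       map_add' := fun x y => by rw [map_add]; rfl } :
      Z →+ UniformOnFun X 𝕜 {B : Set X | IsBoundedFor 𝕜 τ B}) h.isUniformInducing

theorem continuousSMul (h : IsBoundedlyContinuousDual 𝕜 τ τ' b) (hBBC : SatisfiesBBC 𝕜 τ τ') :
    ContinuousSMul 𝕜 Z := by
  let φ : Z →ₗ[𝕜] (X → 𝕜) :=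
    { toFun := fun z => b z
      map_add' := fun x y => by rw [map_add]; rfl
      map_smul' := fun c x => by rw [map_smul]; rfl }
  refine UniformOnFun.continuousSMul_induced_of_image_bounded 𝕜 X 𝕜 Z φ
    h.isUniformInducing.isInducing fun z B hB => ?_
  obtain ⟨C, hC⟩ := h.exists_norm_le hBBC hB z
  rw [NormedSpace.isVonNBounded_iff, isBounded_iff_forall_norm_le]
  exact ⟨C, by rintro _ ⟨x, hx, rfl⟩; exact hC x hx⟩

/-- Bounded sets are stable under scaling, so the radius can be normalised to 1. -/
theorem hasBasis_nhds_zero (h : IsBoundedlyContinuousDual 𝕜 τ τ' b)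
    (hτ : IsLocallyConvexHausdorff 𝕜 τ) :
    (𝓝 (0 : Z)).HasBasis (fun B : Set X => IsBoundedFor 𝕜 τ B)
      fun B => {z | ∀ x ∈ B, ‖b z x‖ ≤ 1} := by
  let _ := τ
  have h0 := (UniformOnFun.hasBasis_nhds_zero_of_basis {B : Set X | IsBoundedFor 𝕜 τ B}
    ⟨∅, isVonNBounded_empty 𝕜 X⟩ (directedOn_of_sup_mem fun _ _ => IsVonNBounded.union)
    (Metric.nhds_basis_closedBall (x := (0 : 𝕜)))).comap
    fun z => UniformOnFun.ofFun {B : Set X | IsBoundedFor 𝕜 τ B} (b z : X → 𝕜)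
  have h1 : (𝓝 (0 : Z)) = comap (fun z =>
      UniformOnFun.ofFun {B : Set X | IsBoundedFor 𝕜 τ B} (b z : X → 𝕜)) (𝓝 0) := by
    rw [h.isUniformInducing.isInducing.nhds_eq_comap, map_zero]
    rfl
  rw [h1]
  refine h0.to_hasBasis ?_ fun B hB => ⟨(B, 1), ⟨hB, one_pos⟩, fun z hz x hx => ?_⟩
  · rintro ⟨B, r⟩ ⟨hB, hr⟩
    refine ⟨((r⁻¹ : ℝ) : 𝕜) • B, hτ.isBoundedFor_smul hB _, fun z hz x hx => ?_⟩
    have := hz _ (Set.smul_mem_smul_set hx)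
    rw [map_smul, norm_smul, RCLike.norm_ofReal, abs_of_pos (inv_pos.2 hr),
      inv_mul_le_one₀ hr] at this
    exact mem_closedBall_zero_iff.2 this
  · exact mem_closedBall_zero_iff.1 (hz x hx)

theorem locallyConvexSpace (h : IsBoundedlyContinuousDual 𝕜 τ τ' b)
    (hτ : IsLocallyConvexHausdorff 𝕜 τ) : LocallyConvexSpace 𝕜 Z := by
  have := h.isUniformAddGroup
  exact LocallyConvexSpace.ofBasisZero 𝕜 Z _ _ (h.hasBasis_nhds_zero hτ)
    fun B _ => (absConvex_setOf_norm_le_one b.flip B).2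

theorem t2Space (h : IsBoundedlyContinuousDual 𝕜 τ τ' b) (hτ : IsLocallyConvexHausdorff 𝕜 τ) :
    T2Space Z := by
  have : T2Space (UniformOnFun X 𝕜 {B : Set X | IsBoundedFor 𝕜 τ B}) :=
    UniformOnFun.t2Space_of_covering
      (Set.eq_univ_of_forall fun x => ⟨{x}, hτ.isBoundedFor_singleton x, rfl⟩)
  exact (Topology.IsEmbedding.mk h.isUniformInducing.isInducing
    fun x y hxy => h.injective (LinearMap.ext fun v => congrFun
      (congrArg (UniformOnFun.toFun _) hxy) v)).t2Space

theorem isVonNBounded_iff (h : IsBoundedlyContinuousDual 𝕜 τ τ' b)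
    (hτ : IsLocallyConvexHausdorff 𝕜 τ) (D : Set Z) :
    IsVonNBounded 𝕜 D ↔
      ∀ B, IsBoundedFor 𝕜 τ B → ∃ C : ℝ, ∀ z ∈ D, ∀ x ∈ B, ‖b z x‖ ≤ C := by
  rw [(h.hasBasis_nhds_zero hτ).isVonNBounded_iff]
  exact forall₂_congr fun B _ => absorbs_setOf_norm_le_one_iff b.flip B D

theorem continuous_apply (h : IsBoundedlyContinuousDual 𝕜 τ τ' b)
    (hτ : IsLocallyConvexHausdorff 𝕜 τ) (x : X) : Continuous fun z => b z x :=
  (UniformOnFun.uniformContinuous_eval_of_mem 𝕜 _ (Set.mem_singleton x)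
    (hτ.isBoundedFor_singleton x)).continuous.comp h.isUniformInducing.isInducing.continuous

/-- The image of `Z` is closed in the complete space of all functions: pointwise convergence
preserves linearity, and uniform convergence on bounded sets preserves continuity there. -/
theorem completeSpace (h : IsBoundedlyContinuousDual 𝕜 τ τ' b)
    (hτ : IsLocallyConvexHausdorff 𝕜 τ) : CompleteSpace Z := by
  refine h.isUniformInducing.completeSpace (IsClosed.isComplete ?_)
  refine isClosed_of_closure_subset fun g hg => ?_
  rw [mem_closure_iff_ultrafilter] at hg
  obtain ⟨u, hu, hug⟩ := hg
  have hunif := UniformOnFun.tendsto_iff_tendstoUniformlyOn.1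
    (show Tendsto id (u : Filter _) (𝓝 g) from hug)
  have hpt : ∀ x, Tendsto (fun f => UniformOnFun.toFun {B : Set X | IsBoundedFor 𝕜 τ B} f x)
      (u : Filter _) (𝓝 (UniformOnFun.toFun _ g x)) := fun x =>
    (hunif {x} (hτ.isBoundedFor_singleton x)).tendsto_at rfl
  let φ : Module.Dual 𝕜 X :=
    { toFun := UniformOnFun.toFun _ g
      map_add' := fun x y => by
        refine tendsto_nhds_unique (hpt (x + y)) (((hpt x).add (hpt y)).congr' ?_)
        filter_upwards [hu]
        rintro _ ⟨z, rfl⟩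
        exact (map_add (b z) x y).symm
      map_smul' := fun c x => by
        refine tendsto_nhds_unique (hpt (c • x)) (((hpt x).const_smul c).congr' ?_)
        filter_upwards [hu]
        rintro _ ⟨z, rfl⟩
        exact (map_smul (b z) c x).symm }
  obtain ⟨z, hz⟩ := (h.mem_range_iff φ).2 fun B hB => by
    let _ := τ'
    refine (hunif B hB).continuousOn (Eventually.frequently ?_)
    filter_upwards [hu]
    rintro _ ⟨z, rfl⟩
    exact h.continuousOn z hB
  exact ⟨z, congrArg (fun φ : Module.Dual 𝕜 X => UniformOnFun.ofFun _ (φ : X → 𝕜)) hz⟩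

/-- The evaluation map from `X` to the strong dual of `Z`. -/
def evalDual (h : IsBoundedlyContinuousDual 𝕜 τ τ' b) (hτ : IsLocallyConvexHausdorff 𝕜 τ)
    [IsUniformAddGroup Z] [ContinuousSMul 𝕜 Z] : X →ₗ[𝕜] StrongDual 𝕜 Z where
  toFun x := ⟨b.flip x, h.continuous_apply hτ x⟩
  map_add' x y := by ext z; exact map_add (b z) x y
  map_smul' c x := by ext z; exact map_smul (b z) c x

theorem evalDual_apply (h : IsBoundedlyContinuousDual 𝕜 τ τ' b)
    (hτ : IsLocallyConvexHausdorff 𝕜 τ) [IsUniformAddGroup Z] [ContinuousSMul 𝕜 Z] (x : X) (z : Z) :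
    h.evalDual hτ x z = b z x := rfl

theorem exists_norm_gt (h : IsBoundedlyContinuousDual 𝕜 τ τ' b)
    (hτ' : IsLocallyConvexHausdorff 𝕜 τ') {U : Set X} (hU : AbsConvex 𝕜 U)
    (hUc : @IsClosed X τ' U) (hne : U.Nonempty) {x : X} (hx : x ∉ U) :
    ∃ z, (∀ y ∈ U, ‖b z y‖ ≤ 1) ∧ 1 < ‖b z x‖ := by
  let _ := τ'
  have := hτ'.isTopologicalAddGroup
  have := hτ'.continuousSMul
  have := hτ'.locallyConvexSpace
  obtain ⟨f, hf, hfx⟩ := hU.exists_strongDual_norm_le_one hUc hne hx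
  obtain ⟨z, hz⟩ := h.exists_eq_of_continuous f f.continuous
  refine ⟨z, fun y hy => ?_, ?_⟩
  · rw [hz]
    exact hf y hy
  · rw [hz]
    exact hfx

/-- The bipolar theorem; it applies because `Z` contains every `τ'`-continuous functional. -/
theorem eq_setOf_norm_le_one (h : IsBoundedlyContinuousDual 𝕜 τ τ' b)
    (hτ' : IsLocallyConvexHausdorff 𝕜 τ') {U : Set X} (hU : AbsConvex 𝕜 U)
    (hUc : @IsClosed X τ' U) (hne : U.Nonempty) :
    U = {x | ∀ z ∈ {z | ∀ y ∈ U, ‖b z y‖ ≤ 1}, ‖b z x‖ ≤ 1} := by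
  refine Set.Subset.antisymm (fun x hx z hz => hz x hx) fun x hx => ?_
  by_contra hxU
  obtain ⟨z, hz, hzx⟩ := h.exists_norm_gt hτ' hU hUc hne hxU
  exact hzx.not_ge (hx z hz)

theorem evalDual_injective (h : IsBoundedlyContinuousDual 𝕜 τ τ' b)
    (hτ : IsLocallyConvexHausdorff 𝕜 τ) (hτ' : IsLocallyConvexHausdorff 𝕜 τ')
    [IsUniformAddGroup Z] [ContinuousSMul 𝕜 Z] : Function.Injective (h.evalDual hτ) := by
  rw [injective_iff_map_eq_zero]
  intro x hx
  by_contra hx0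
  let _ := τ'
  have := hτ'.t2Space
  have h0 : AbsConvex 𝕜 ({0} : Set X) :=
    ⟨balanced_iff_smul_mem.2 fun {c} _ y hy => by simp_all, convex_singleton 0⟩
  obtain ⟨z, -, hz⟩ := h.exists_norm_gt hτ' h0 isClosed_singleton ⟨0, rfl⟩ hx0
  have := DFunLike.congr_fun hx z
  rw [evalDual_apply] at this
  rw [this] at hz
  norm_num at hz

/-- Mackey–Arens: `ψ` is bounded by 1 on the polar of some bounded `B`, so it lies in the bipolar of
a compact disc `K ⊇ B`, and this bipolar is the image of `K` itself. -/
theorem evalDual_surjective (h : IsBoundedlyContinuousDual 𝕜 τ τ' b)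
    (hτ : IsLocallyConvexHausdorff 𝕜 τ) (hBBC : SatisfiesBBC 𝕜 τ τ')
    [IsUniformAddGroup Z] [ContinuousSMul 𝕜 Z] : Function.Surjective (h.evalDual hτ) := by
  intro ψ
  have hψ : {z | ‖ψ z‖ ≤ 1} ∈ 𝓝 (0 : Z) := by
    have := (ψ.continuous.norm.tendsto 0).eventually_le_const (u := 1) (by simp)
    exact this
  obtain ⟨B, hB, hBψ⟩ := (h.hasBasis_nhds_zero hτ).mem_iff.1 hψ
  -- Adjoining `0` keeps `K` nonempty even if `B` is empty.
  obtain ⟨K, hBK, hK, hKb, hKc⟩ := hBBC (B ∪ {0})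
    (@IsVonNBounded.union 𝕜 X _ _ _ τ _ _ hB (hτ.isBoundedFor_singleton 0))
  have hne : K.Nonempty := ⟨0, hBK (Or.inr rfl)⟩
  -- The compactness argument takes place in the full algebraic dual of `Z`, with its pointwise
  -- topology.
  let P : Module.Dual 𝕜 Z →ₗ[𝕜] Z →ₗ[𝕜] 𝕜 := LinearMap.id
  let e : X →ₗ[𝕜] WeakBilin P := b.flip
  have hcomp : IsCompact (e '' K) := by
    let _ := τ'
    refine hKc.image_of_continuousOn
      ((WeakBilin.isEmbedding (B := P) Function.injective_id).isInducing.continuousOn_iff.2 ?_)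
    exact continuousOn_pi.2 fun z => h.continuousOn z hKb
  have habs : AbsConvex 𝕜 (e '' K) := by
    refine ⟨balanced_iff_smul_mem.2 ?_, hK.2.linear_image e⟩
    rintro c hc _ ⟨x, hx, rfl⟩
    exact ⟨c • x, hK.1.smul_mem hc hx, map_smul e c x⟩
  obtain ⟨x, -, hx⟩ := WeakBilin.mem_of_isCompact_of_absConvex P Function.injective_id hcomp habs
    (hne.image e) (ψ := (ψ : Z →ₗ[𝕜] 𝕜))
    fun z hz => hBψ fun x hx => hz (e x) ⟨x, hBK (Or.inl hx), rfl⟩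
  exact ⟨x, ContinuousLinearMap.ext fun z => LinearMap.congr_fun (f := b.flip x) hx z⟩

theorem isVonNBounded_polar (h : IsBoundedlyContinuousDual 𝕜 τ τ' b)
    (hτ : IsLocallyConvexHausdorff 𝕜 τ) {U : Set X} (hU : U ∈ @nhds X τ 0) :
    IsVonNBounded 𝕜 {z | ∀ x ∈ U, ‖b z x‖ ≤ 1} := by
  refine (h.isVonNBounded_iff hτ _).2 fun B hB => ?_
  obtain ⟨C, hC⟩ := (absorbs_setOf_norm_le_one_iff b {z | ∀ x ∈ U, ‖b z x‖ ≤ 1} B).1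
    ((show Absorbs 𝕜 U B from hB hU).mono_left fun x hx z hz => hz x hx)
  exact ⟨C, fun z hz x hx => hC x hx z hz⟩

/-- Let `A` be the polar in `X` of the unit ball of `p`. A (CNC) neighbourhood `U` has a Banach disc
as polar, on which `p ≤ C`; hence `A ⊆ C • U` and `A` is bounded. The polar of `A` is then a
neighbourhood of `0`, and it lies in the unit ball of `p` by Hahn–Banach. -/
theorem barrelledSpace (h : IsBoundedlyContinuousDual 𝕜 τ τ' b)
    (hτ : IsLocallyConvexHausdorff 𝕜 τ) (hτ' : IsLocallyConvexHausdorff 𝕜 τ')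
    (hBBC : SatisfiesBBC 𝕜 τ τ') (hCNC : SatisfiesCNC 𝕜 τ τ') : BarrelledSpace 𝕜 Z := by
  refine ⟨fun p hp => ?_⟩
  have := h.isUniformAddGroup
  have := h.continuousSMul hBBC
  have := h.completeSpace hτ
  have := h.locallyConvexSpace hτ
  have hA : IsBoundedFor 𝕜 τ {x | ∀ z, p z ≤ 1 → ‖b z x‖ ≤ 1} := by
    refine (@Filter.HasBasis.isVonNBounded_iff 𝕜 X _ _ _ _ τ _ _ _ hCNC).2 ?_
    rintro U ⟨hU, hUa, hUc⟩
    have h0 : (0 : X) ∈ U := @mem_of_mem_nhds X τ 0 U hU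
    obtain ⟨C, hC0, hC⟩ := Seminorm.exists_forall_le_of_lowerSemicontinuous
      (fun x : U => h.evalDual hτ x.1)
      (fun z hz => h.injective (LinearMap.ext fun v => by
        have habs := @absorbent_nhds_zero 𝕜 X _ _ _ U τ hτ.continuousSMul hU
        obtain ⟨c, hc⟩ := (habs v).eventually.exists
        obtain ⟨u, hu, rfl⟩ := hc rfl
        have hzu : b z u = 0 := hz ⟨u, hu⟩
        simp [hzu]))
      ((h.isVonNBounded_polar hτ hU).subset fun z hz x hx => hz ⟨x, hx⟩) p hp
    have hU' := h.eq_setOf_norm_le_one hτ' hUa hUc ⟨0, h0⟩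
    rw [id, hU', absorbs_setOf_norm_le_one_iff]
    refine ⟨C, fun x hx z hz => ?_⟩
    have hpz := hC z fun y => hz y.1 y.2
    have hn : ‖((C⁻¹ : ℝ) : 𝕜)‖ = C⁻¹ := by
      rw [RCLike.norm_ofReal, abs_of_pos (inv_pos.2 hC0)]
    have := hx (((C⁻¹ : ℝ) : 𝕜) • z) (by
      rw [map_smul_eq_mul, hn, inv_mul_le_one₀ hC0]
      exact hpz)
    rwa [map_smul, LinearMap.smul_apply, norm_smul, hn, inv_mul_le_one₀ hC0] at this
  refine Seminorm.continuous' (r := 1) ?_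
  refine (h.hasBasis_nhds_zero hτ).mem_iff.2 ⟨_, hA, fun z hz => ?_⟩
  rw [Seminorm.mem_closedBall_zero]
  by_contra hpz
  -- The separating functional is evaluation at some `x`, and this `x` belongs to the polar of the
  -- unit ball.
  obtain ⟨f, hf, hfz⟩ := (p.absConvex_setOf_le 1).exists_strongDual_norm_le_one (hp.isClosed_preimage 1)
    ⟨0, by simp⟩ hpz
  obtain ⟨x, rfl⟩ := h.evalDual_surjective hτ hBBC f
  exact hfz.not_ge (hz x hf)

theorem isHomeomorph_evalDual (h : IsBoundedlyContinuousDual 𝕜 τ τ' b)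
    (hτ : IsLocallyConvexHausdorff 𝕜 τ) (hborn : IsBornological 𝕜 τ)
    (hτ' : IsLocallyConvexHausdorff 𝕜 τ') (hBBC : SatisfiesBBC 𝕜 τ τ')
    (hCNC : SatisfiesCNC 𝕜 τ τ') [IsUniformAddGroup Z] [ContinuousSMul 𝕜 Z] :
    @IsHomeomorph X (StrongDual 𝕜 Z) τ _ (h.evalDual hτ) := by
  let _ := τ
  have := hτ.isTopologicalAddGroup
  let T : X ≃+ StrongDual 𝕜 Z := AddEquiv.ofBijective (h.evalDual hτ)
    ⟨h.evalDual_injective hτ hτ', h.evalDual_surjective hτ hBBC⟩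
  have hT : Continuous T := by
    refine continuous_of_continuousAt_zero T ?_
    rw [ContinuousAt, map_zero, (ContinuousLinearMap.hasBasis_nhds_zero_of_basis
      Metric.nhds_basis_closedBall).tendsto_right_iff]
    rintro ⟨D, r⟩ ⟨hD, hr⟩
    have hD' : IsVonNBounded 𝕜 (((r⁻¹ : ℝ) : 𝕜) • D) :=
      hD.image (((r⁻¹ : ℝ) : 𝕜) • ContinuousLinearMap.id 𝕜 Z)
    -- A bounded subset of `Z` is uniformly bounded on every bounded `B`, so its polar absorbs `B`.
    refine mem_of_superset (hborn _ (absConvex_setOf_norm_le_one b (((r⁻¹ : ℝ) : 𝕜) • D))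
      fun B hB => ?_) fun x hx z hz => ?_
    · obtain ⟨C, hC⟩ := (h.isVonNBounded_iff hτ _).1 hD' B hB
      exact (absorbs_setOf_norm_le_one_iff b _ B).2 ⟨C, fun x hx z hz => hC z hz x hx⟩
    · have := hx _ (Set.smul_mem_smul_set hz)
      rw [map_smul, LinearMap.smul_apply, norm_smul, RCLike.norm_ofReal,
        abs_of_pos (inv_pos.2 hr), inv_mul_le_one₀ hr] at this
      exact mem_closedBall_zero_iff.2 this
  have hTs : Continuous T.symm := by
    refine continuous_of_continuousAt_zero T.symm ?_
    rw [ContinuousAt, map_zero, hCNC.tendsto_right_iff]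
    rintro U ⟨hU, hUa, hUc⟩
    refine ((ContinuousLinearMap.hasBasis_nhds_zero_of_basis
      (Metric.nhds_basis_closedBall (x := (0 : 𝕜)))).mem_of_mem
      (i := ({z | ∀ x ∈ U, ‖b z x‖ ≤ 1}, 1))
      ⟨h.isVonNBounded_polar hτ hU, one_pos⟩ |> mem_of_superset) fun f hf => ?_
    change T.symm f ∈ U
    rw [h.eq_setOf_norm_le_one hτ' hUa hUc ⟨0, mem_of_mem_nhds hU⟩]
    intro z hz
    have h1 : T (T.symm f) z = f z := by rw [T.apply_symm_apply]
    have h2 : b z (T.symm f) = f z := h1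
    rw [h2]
    exact mem_closedBall_zero_iff.1 (hf z hz)
  exact (Homeomorph.mk T.toEquiv hT hTs).isHomeomorph

end IsBoundedlyContinuousDual
-- The weak-* topology transported from a strong dual.
section StrongDual

variable {𝕜 : Type*} [RCLike 𝕜] {X Y : Type*} [AddCommGroup X] [Module 𝕜 X] [AddCommGroup Y]
  [Module 𝕜 Y] [UniformSpace Y]
  {τ : TopologicalSpace X} (T : X ≃ₗ[𝕜] StrongDual 𝕜 Y)

/-- The topology on `X` transported from the weak-* topology along `T`. -/
@[reducible]
def weakStarTopology : TopologicalSpace X :=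
  TopologicalSpace.induced (fun f y => T f y) Pi.topologicalSpace

theorem isLocallyConvexHausdorff_weakStarTopology :
    IsLocallyConvexHausdorff 𝕜 (weakStarTopology T) := by
  let e : X →ₗ[𝕜] Y → 𝕜 :=
    { toFun := fun f y => T f y
      map_add' := fun f g => by rw [map_add]; rfl
      map_smul' := fun c f => by rw [map_smul]; rfl }
  have := locallyConvexSpace_rclike (𝕜 := 𝕜)
  have he : Function.Injective e := fun f g h =>
    T.injective (ContinuousLinearMap.ext fun y => congrFun h y)
  refine ⟨topologicalAddGroup_induced e, continuousSMul_induced e, LocallyConvexSpace.induced e, ?_⟩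
  let _ := weakStarTopology T
  exact (IsEmbedding.mk (IsInducing.mk rfl) he).t2Space

theorem continuous_weakStarTopology_apply (y : Y) :
    @Continuous X 𝕜 (weakStarTopology T) _ fun f => T f y := by
  let _ := weakStarTopology T
  exact (continuous_apply y).comp continuous_induced_dom

theorem isClosed_weakStarTopology_polar (D : Set Y) :
    @IsClosed X (weakStarTopology T) {f | ∀ y ∈ D, ‖T f y‖ ≤ 1} := by
  let _ := weakStarTopology T
  simp only [Set.ofPred_forall]
  exact isClosed_biInter fun y _ =>
    isClosed_le (continuous_weakStarTopology_apply T y).norm continuous_const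

theorem absConvex_strongDual_polar (D : Set Y) : AbsConvex 𝕜 {f | ∀ y ∈ D, ‖T f y‖ ≤ 1} :=
  absConvex_setOf_norm_le_one
    (fun y => { toFun := fun f => T f y
                map_add' := fun f g => by rw [map_add]; rfl
                map_smul' := fun c f => by rw [map_smul]; rfl }) D

theorem isVonNBounded_strongDual_polar {V : Set Y} (hV : V ∈ 𝓝 0) :
    IsVonNBounded 𝕜 {g : StrongDual 𝕜 Y | ∀ y ∈ V, ‖g y‖ ≤ 1} := by
  rw [ContinuousLinearMap.isVonNBounded_iff]
  intro s hs
  obtain ⟨c, hc⟩ := (hs hV).exists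
  rw [NormedSpace.isVonNBounded_iff, isBounded_iff_forall_norm_le]
  refine ⟨‖c‖, ?_⟩
  rintro _ ⟨g, hg, y, hy, rfl⟩
  obtain ⟨v, hv, rfl⟩ := hc hy
  simp only [map_smul, norm_smul]
  exact mul_le_of_le_one_right (norm_nonneg c) (hg v hv)

variable [ContinuousSMul 𝕜 Y]

/-- Polars of bounded subsets of `Y` form a neighbourhood basis of the strong topology and are
weak-* closed. -/
theorem satisfiesCNC_weakStarTopology (hT : @IsHomeomorph X (StrongDual 𝕜 Y) τ _ T) :
    SatisfiesCNC 𝕜 τ (weakStarTopology T) := by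
  let _ := τ
  have hbasis := (ContinuousLinearMap.hasBasis_nhds_zero_of_basis (𝕜₁ := 𝕜) (E := Y)
    (σ := RingHom.id 𝕜) (Metric.nhds_basis_closedBall (x := (0 : 𝕜)))).comap T
  have hnhds : 𝓝 (0 : X) = comap T (𝓝 0) := by
    rw [hT.isInducing.nhds_eq_comap, map_zero]
  rw [← hnhds] at hbasis
  refine ⟨fun W => ⟨fun hW => ?_, fun ⟨U, hU, hUW⟩ => mem_of_superset hU.1 hUW⟩⟩
  obtain ⟨⟨D, r⟩, ⟨hD, hr⟩, hW⟩ := hbasis.mem_iff.1 hW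
  have hD' : IsVonNBounded 𝕜 (((r⁻¹ : ℝ) : 𝕜) • D) :=
    hD.image (((r⁻¹ : ℝ) : 𝕜) • ContinuousLinearMap.id 𝕜 Y)
  refine ⟨{f | ∀ y ∈ ((r⁻¹ : ℝ) : 𝕜) • D, ‖T f y‖ ≤ 1}, ⟨?_, absConvex_strongDual_polar T _,
    isClosed_weakStarTopology_polar T _⟩, fun f hf => hW fun y hy => ?_⟩
  · refine mem_of_superset (hbasis.mem_of_mem (i := (_, 1)) ⟨hD', one_pos⟩) fun f hf y hy => ?_
    exact mem_closedBall_zero_iff.1 (hf y hy)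
  · have := hf _ (Set.smul_mem_smul_set hy)
    rw [map_smul, norm_smul, RCLike.norm_ofReal, abs_of_pos (inv_pos.2 hr),
      inv_mul_le_one₀ hr] at this
    exact mem_closedBall_zero_iff.2 this

variable [IsUniformAddGroup Y]

/-- The Banach–Alaoglu theorem. -/
theorem isCompact_weakStarTopology_polar {V : Set Y} (hV : V ∈ 𝓝 0) :
    @IsCompact X (weakStarTopology T) {f | ∀ y ∈ V, ‖T f y‖ ≤ 1} := by
  let _ := weakStarTopology T
  have he : IsInducing fun (f : X) (y : Y) => T f y := ⟨rfl⟩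
  rw [he.isCompact_iff]
  have habs : ∀ y, ∃ C : ℝ, ∀ f, (∀ y ∈ V, ‖T f y‖ ≤ 1) → ‖T f y‖ ≤ C := fun y => by
    obtain ⟨c, hc⟩ := (absorbent_nhds_zero (𝕜 := 𝕜) hV y).eventually.exists
    obtain ⟨v, hv, hvy⟩ := hc rfl
    refine ⟨‖c‖, fun f hf => ?_⟩
    have hvy' : c • v = y := hvy
    rw [← hvy', map_smul, norm_smul]
    exact mul_le_of_le_one_right (norm_nonneg c) (hf v hv)
  choose C hC using habs
  -- By Tychonoff, it suffices that the polar is closed in a product of discs.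
  refine (isCompact_univ_pi fun y => isCompact_closedBall (0 : 𝕜) (C y)).of_isClosed_subset ?_ ?_
  · have hset : (fun (f : X) (y : Y) => T f y) '' {f | ∀ y ∈ V, ‖T f y‖ ≤ 1} =
        {g : Y → 𝕜 | (∀ x y, g (x + y) = g x + g y) ∧ (∀ (c : 𝕜) x, g (c • x) = c * g x) ∧
          ∀ y ∈ V, ‖g y‖ ≤ 1} := by
      refine Set.Subset.antisymm ?_ fun g hg => ?_
      · rintro _ ⟨f, hf, rfl⟩
        exact ⟨fun x y => map_add _ _ _, fun c x => map_smul _ _ _, hf⟩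
      -- A linear `g` bounded on the neighbourhood `V` is automatically continuous.
      · let φ : Y →ₗ[𝕜] 𝕜 := ⟨⟨g, hg.1⟩, hg.2.1⟩
        let ψ : StrongDual 𝕜 Y :=
          φ.clmOfExistsBoundedImage ⟨V, hV, by
            rw [NormedSpace.isVonNBounded_iff, isBounded_iff_forall_norm_le]
            exact ⟨1, by rintro _ ⟨y, hy, rfl⟩; exact hg.2.2 y hy⟩⟩
        have hψ : (fun y => T (T.symm ψ) y) = g := by
          rw [T.apply_symm_apply]
          rfl
        exact ⟨T.symm ψ, fun y hy => (congrArg norm (congrFun hψ y)).trans_le (hg.2.2 y hy), hψ⟩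
    rw [hset]
    simp only [Set.ofPred_and, Set.ofPred_forall]
    refine IsClosed.inter ?_ (IsClosed.inter ?_ ?_)
    · exact isClosed_iInter fun x => isClosed_iInter fun y =>
        isClosed_eq (continuous_apply (x + y)) ((continuous_apply x).add (continuous_apply y))
    · exact isClosed_iInter fun c => isClosed_iInter fun x =>
        isClosed_eq (continuous_apply _) (continuous_const.mul (continuous_apply _))
    · exact isClosed_biInter fun y _ => isClosed_le (continuous_apply _).norm continuous_const
  · rintro _ ⟨f, hf, rfl⟩ y -
    exact mem_closedBall_zero_iff.2 (hC y f hf)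

/-- Banach–Steinhaus: strongly bounded families are pointwise bounded. -/
theorem equicontinuous_of_isBoundedFor [BarrelledSpace 𝕜 Y]
    (hT : @IsHomeomorph X (StrongDual 𝕜 Y) τ _ T) {B : Set X} (hB : IsBoundedFor 𝕜 τ B) :
    Equicontinuous fun (f : B) (y : Y) => T f.1 y := by
  let _ := τ
  let TL : X →L[𝕜] StrongDual 𝕜 Y := ⟨T, hT.continuous⟩
  refine (PolynormableSpace.banach_steinhaus (𝓕 := fun f : B => T f.1)
    fun y => ?_).equicontinuous
  have := hB.image (⟨(LinearMap.applyₗ y).comp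
    ((ContinuousLinearMap.coeLM 𝕜).comp TL.toLinearMap),
    (continuous_eval_const y).comp TL.continuous⟩ : X →L[𝕜] 𝕜)
  rw [Set.image_eq_range] at this
  exact this

theorem satisfiesBBC_weakStarTopology [BarrelledSpace 𝕜 Y]
    (hT : @IsHomeomorph X (StrongDual 𝕜 Y) τ _ T) : SatisfiesBBC 𝕜 τ (weakStarTopology T) := by
  intro B hB
  have hV : {y : Y | ∀ f ∈ B, ‖T f y‖ ≤ 1} ∈ 𝓝 0 := by
    filter_upwards [Metric.equicontinuousAt_iff_right.1 (equicontinuous_of_isBoundedFor T hT hB 0)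
      1 one_pos] with y hy f hf
    have := hy ⟨f, hf⟩
    rw [map_zero, dist_zero_left] at this
    exact this.le
  -- The enclosing compact set is the bipolar of `B`.
  refine ⟨{f | ∀ y ∈ {y : Y | ∀ f ∈ B, ‖T f y‖ ≤ 1}, ‖T f y‖ ≤ 1},
    fun f hf y hy => hy f hf, absConvex_strongDual_polar T _, ?_,
    isCompact_weakStarTopology_polar T hV⟩
  let _ := τ
  let TS : StrongDual 𝕜 Y →L[𝕜] X :=
    ⟨T.symm, (hT.isInducing.continuous_iff).2 (by
      convert! continuous_id
      exact funext T.apply_symm_apply)⟩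
  have hsub : {f | ∀ y ∈ {y : Y | ∀ f ∈ B, ‖T f y‖ ≤ 1}, ‖T f y‖ ≤ 1} ⊆
      TS '' {g | ∀ y ∈ {y : Y | ∀ f ∈ B, ‖T f y‖ ≤ 1}, ‖g y‖ ≤ 1} :=
    fun f hf => ⟨T f, hf, T.symm_apply_apply f⟩
  exact ((isVonNBounded_strongDual_polar hV).image TS).subset hsub

end StrongDual
-- Linearisations, equicontinuity and point evaluations.
section FunctionSpaces

variable {𝕜 : Type v} [RCLike 𝕜] {Ω : Type u} [TopologicalSpace Ω] {F : Submodule 𝕜 (Ω → 𝕜)}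
  {τ τ' : TopologicalSpace F}

theorem continuous_pointEvaluation (hδ : ∀ x : Ω, pointEvaluation F x ∈ boundedlyContinuousDual 𝕜 τ τ')
    (h : ∀ B : Set F, IsBoundedFor 𝕜 τ B → ∀ x₀, ∀ ε > 0, ∀ᶠ x in 𝓝 x₀, ∀ f ∈ B,
      dist (f.1 x₀) (f.1 x) < ε) :
    @Continuous Ω (boundedlyContinuousDual 𝕜 τ τ') _ (boundedlyContinuousDualTopology 𝕜 τ τ')
      (fun x => ⟨pointEvaluation F x, hδ x⟩) := by
  refine continuous_induced_rng.2 (continuous_iff_continuousAt.2 fun x₀ => ?_)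
  refine UniformOnFun.tendsto_iff_tendstoUniformlyOn.2 fun B hB => ?_
  exact Metric.tendstoUniformlyOn_iff.2 fun ε hε => h B hB x₀ ε hε

/-- A space with a continuous strong complete barrelled linearisation satisfies (BBC) and (CNC) for a
topology finer than that of pointwise convergence, and its bounded sets are equicontinuous. -/
theorem exists_bbc_cnc_of_admitsLinearisation
    (h : AdmitsContinuousStrongCompleteBarrelledLinearisation.{u, v, w} F τ) :
    (∃ τ' : TopologicalSpace F, IsLocallyConvexHausdorff 𝕜 τ' ∧
        SatisfiesBBC 𝕜 τ τ' ∧ SatisfiesCNC 𝕜 τ τ' ∧ τ' ≤ pointwiseTopology F) ∧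
      ∀ B : Set F, IsBoundedFor 𝕜 τ B → Equicontinuous (fun f : B => (f.1.1 : Ω → 𝕜)) := by
  obtain ⟨Y, _, _, _, _, _, _, _, δ, T, -, _, hT, hδ⟩ := h
  refine ⟨⟨weakStarTopology T, isLocallyConvexHausdorff_weakStarTopology T,
    satisfiesBBC_weakStarTopology T hT.isHomeomorph,
    satisfiesCNC_weakStarTopology T hT.isHomeomorph, ?_⟩, fun B hB x₀ U hU => ?_⟩
  · let _ := weakStarTopology T
    refine continuous_iff_le_induced.1 (continuous_pi fun x => ?_)
    refine (continuous_weakStarTopology_apply T (δ x)).congr fun f => ?_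
    exact congrFun (hT.comp_eq f) x
  · filter_upwards [hδ.tendsto x₀ |>.eventually
      (equicontinuous_of_isBoundedFor T hT.isHomeomorph hB (δ x₀) U hU)] with x hx f
    have := hx f
    have h1 : ∀ x, T f.1 (δ x) = f.1.1 x := congrFun (hT.comp_eq f.1)
    rwa [h1, h1] at this

/-- If the bounded sets are equicontinuous, the point evaluations depend continuously on the point. -/
theorem exists_continuous_pointEvaluation_of_equicontinuous (hle : τ' ≤ pointwiseTopology F)
    (heq : ∀ B : Set F, IsBoundedFor 𝕜 τ B → Equicontinuous (fun f : B => (f.1.1 : Ω → 𝕜))) :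
    ∃ hδ : ∀ x : Ω, pointEvaluation F x ∈ boundedlyContinuousDual 𝕜 τ τ',
      @Continuous Ω (boundedlyContinuousDual 𝕜 τ τ') _ (boundedlyContinuousDualTopology 𝕜 τ τ')
        (fun x => ⟨pointEvaluation F x, hδ x⟩) := by
  refine ⟨fun x B _ => ?_, continuous_pointEvaluation _ fun B hB x₀ ε hε => ?_⟩
  · let _ := τ'
    exact ((continuous_apply x).comp (continuous_iff_le_induced.2 hle)).continuousOn
  · filter_upwards [Metric.equicontinuousAt_iff_right.1 (heq B hB x₀) ε hε] with x hx f hf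
    exact hx ⟨f, hf⟩

/-- Under (BBC) and (CNC), `boundedlyContinuousDual 𝕜 τ τ'` together with the point evaluations is a
strong complete barrelled linearisation. -/
theorem admitsLinearisation_of_continuous_pointEvaluation (hτ : IsLocallyConvexHausdorff 𝕜 τ)
    (hborn : IsBornological 𝕜 τ) (hτ' : IsLocallyConvexHausdorff 𝕜 τ')
    (hBBC : SatisfiesBBC 𝕜 τ τ') (hCNC : SatisfiesCNC 𝕜 τ τ')
    (hδ : ∀ x : Ω, pointEvaluation F x ∈ boundedlyContinuousDual 𝕜 τ τ')
    (hcont : @Continuous Ω (boundedlyContinuousDual 𝕜 τ τ') _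
      (boundedlyContinuousDualTopology 𝕜 τ τ') (fun x => ⟨pointEvaluation F x, hδ x⟩)) :
    AdmitsContinuousStrongCompleteBarrelledLinearisation.{u, v, w} F τ := by
  -- The lift places the predual in the universe required of `Y`.
  let e : ULift.{w} (boundedlyContinuousDual 𝕜 τ τ') ≃ₗ[𝕜] boundedlyContinuousDual 𝕜 τ τ' :=
    ULift.moduleEquiv
  let uZ : UniformSpace (ULift.{w} (boundedlyContinuousDual 𝕜 τ τ')) :=
    UniformSpace.comap
      (fun z => UniformOnFun.ofFun {B : Set F | IsBoundedFor 𝕜 τ B} ((e z).1 : F → 𝕜)) inferInstance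
  have he : IsUniformInducing fun z =>
    UniformOnFun.ofFun {B : Set F | IsBoundedFor 𝕜 τ B} ((e z).1 : F → 𝕜) := ⟨rfl⟩
  have hb := isBoundedlyContinuousDual_of_linearEquiv
    (Z := ULift.{w} (boundedlyContinuousDual 𝕜 τ τ')) e he
  have := hb.isUniformAddGroup
  have := hb.continuousSMul hBBC
  refine ⟨_, _, _, uZ, hb.isUniformAddGroup, hb.continuousSMul hBBC, hb.locallyConvexSpace hτ,
    hb.t2Space hτ, fun x => ⟨⟨pointEvaluation F x, hδ x⟩⟩,
    LinearEquiv.ofBijective (hb.evalDual hτ)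
      ⟨hb.evalDual_injective hτ hτ', hb.evalDual_surjective hτ hBBC⟩,
    hb.completeSpace hτ, hb.barrelledSpace hτ hτ' hBBC hCNC,
    ⟨hb.isHomeomorph_evalDual hτ hborn hτ' hBBC hCNC, fun f => rfl⟩, ?_⟩
  have hcont' : Continuous fun x => UniformOnFun.ofFun {B : Set F | IsBoundedFor 𝕜 τ B}
      (pointEvaluation F x : F → 𝕜) := by
    let _ := boundedlyContinuousDualTopology 𝕜 τ τ'
    have hdom : Continuous fun φ : boundedlyContinuousDual 𝕜 τ τ' =>
        UniformOnFun.ofFun {B : Set F | IsBoundedFor 𝕜 τ B} (φ.1 : F → 𝕜) := continuous_induced_dom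
    exact hdom.comp hcont
  exact he.isInducing.continuous_iff.2 hcont'

/-- On a `gk_ℝ`-space, a set of continuous functions that is compact for a topology finer than the
compact-open topology is equicontinuous. -/
theorem IsGkRSpace.eventually_dist_lt (hΩ : IsGkRSpace.{u, w'} Ω) (hF : ∀ f ∈ F, Continuous f)
    (hle : τ' ≤ compactOpenTopology F) {K : Set F} (hK : @IsCompact F τ' K) (x₀ : Ω) {ε : ℝ}
    (hε : 0 < ε) : ∀ᶠ x in 𝓝 x₀, ∀ f ∈ K, dist (f.1 x₀) (f.1 x) < ε := by
  let _ := τ'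
  have hunif : ∀ (f : F) (C : Set Ω), IsCompact C →
      TendstoUniformlyOn (fun g : F => g.1) f.1 (𝓝 f) C := fun f C hC =>
    UniformOnFun.tendsto_iff_tendstoUniformlyOn.1
      ((continuous_iff_le_induced.2 hle).tendsto f) C hC
  -- Evaluation is jointly continuous on `C × F`: near `f`, functions are uniformly close to `f` on
  -- `C`, and `f` is continuous.
  have heval : ∀ C : Set Ω, IsCompact C → Continuous fun p : C × F => p.2.1 p.1.1 := fun C hC => by
    refine continuous_iff_continuousAt.2 fun ⟨x, f⟩ => ?_
    refine tendsto_comp_of_locally_uniform_limit_within (s := C)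
      (F := fun p : C × F => p.2.1) (g := fun p : C × F => p.1.1)
      (hF f.1 f.2).continuousWithinAt ?_ fun u hu => ⟨C, self_mem_nhdsWithin, ?_⟩
    · exact tendsto_nhdsWithin_iff.2 ⟨(continuous_subtype_val.comp continuous_fst).tendsto _,
        Eventually.of_forall fun p => p.1.2⟩
    · exact (continuous_snd.tendsto (x, f)).eventually (hunif f C hC u hu)
  have hx₀ : Continuous fun f : F => f.1 x₀ :=
    (heval {x₀} isCompact_singleton).comp
      (continuous_const.prodMk continuous_id : Continuous fun f : F => ((⟨x₀, rfl⟩ : ({x₀} : Set Ω)), f))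
  have hsup : Continuous fun x => sSup ((fun f : F => dist (f.1 x₀) (f.1 x)) '' K) := by
    -- The test spaces in `hΩ` live in universe `w'`, so `ℝ` is lifted there.
    have : CompletelyRegularSpace (ULift.{w'} ℝ) :=
      (Homeomorph.ulift (X := ℝ)).isInducing.completelyRegularSpace
    refine continuous_uliftDown.comp (hΩ (ULift.{w'} ℝ)
      (fun x => ⟨sSup ((fun f : F => dist (f.1 x₀) (f.1 x)) '' K)⟩) fun C hC => ?_)
    rw [continuousOn_iff_continuous_domRestrict]
    refine continuous_uliftUp.comp (hK.continuous_sSup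
      (f := fun (x : C) (f : F) => dist (f.1 x₀) (f.1 x.1)) ?_)
    exact (hx₀.comp continuous_snd).dist (heval C hC)
  -- Stated via `Real.sSup_nonpos`, which also covers empty `K`.
  have h0 : sSup ((fun f : F => dist (f.1 x₀) (f.1 x₀)) '' K) < ε := by
    refine lt_of_le_of_lt (Real.sSup_nonpos ?_) hε
    rintro _ ⟨f, -, rfl⟩
    exact (dist_self _).le
  filter_upwards [hsup.continuousAt.eventually_lt_const h0] with x hx f hf
  refine lt_of_le_of_lt (le_csSup ?_ (Set.mem_image_of_mem (fun f : F => dist (f.1 x₀) (f.1 x)) hf)) hx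
  refine hK.bddAbove_image (Continuous.continuousOn (hx₀.dist ?_))
  exact (heval {x} isCompact_singleton).comp
    (continuous_const.prodMk continuous_id : Continuous fun f : F => ((⟨x, rfl⟩ : ({x} : Set Ω)), f))

theorem IsGkRSpace.exists_continuous_pointEvaluation (hΩ : IsGkRSpace.{u, w'} Ω)
    (hF : ∀ f ∈ F, Continuous f) (hBBC : SatisfiesBBC 𝕜 τ τ') (hle : τ' ≤ compactOpenTopology F) :
    ∃ hδ : ∀ x : Ω, pointEvaluation F x ∈ boundedlyContinuousDual 𝕜 τ τ',
      @Continuous Ω (boundedlyContinuousDual 𝕜 τ τ') _ (boundedlyContinuousDualTopology 𝕜 τ τ')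
        (fun x => ⟨pointEvaluation F x, hδ x⟩) := by
  refine ⟨fun x B _ => ?_, continuous_pointEvaluation _ fun B hB x₀ ε hε => ?_⟩
  · let _ := τ'
    exact ((UniformOnFun.uniformContinuous_eval_of_mem 𝕜 {K : Set Ω | IsCompact K}
      (Set.mem_singleton x) isCompact_singleton).continuous.comp
        (continuous_iff_le_induced.2 hle)).continuousOn
  · obtain ⟨K, hBK, -, -, hK⟩ := hBBC B hB
    filter_upwards [hΩ.eventually_dist_lt hF hle hK x₀ hε] with x hx f hf
    exact hx f (hBK hf)

end FunctionSpaces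

theorem mainTheorem3 {𝕜 : Type v} [RCLike 𝕜] {Ω : Type u} [TopologicalSpace Ω] [T2Space Ω]
    [Nonempty Ω] (F : Submodule 𝕜 (Ω → 𝕜)) (hF : ∀ f ∈ F, Continuous f)
    (τ : TopologicalSpace F) (hτ : IsLocallyConvexHausdorff 𝕜 τ) (hborn : IsBornological 𝕜 τ) :
    -- (a) ⇔ (b)
    (AdmitsContinuousStrongCompleteBarrelledLinearisation.{u, v, w} F τ ↔
      (∃ τ' : TopologicalSpace F, IsLocallyConvexHausdorff 𝕜 τ' ∧
        SatisfiesBBC 𝕜 τ τ' ∧ SatisfiesCNC 𝕜 τ τ' ∧ τ' ≤ pointwiseTopology F) ∧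
      ∀ B : Set F, IsBoundedFor 𝕜 τ B → Equicontinuous (fun f : B => (f.1.1 : Ω → 𝕜))) ∧
    -- (a) ⇔ (c)
    (AdmitsContinuousStrongCompleteBarrelledLinearisation.{u, v, w} F τ ↔
      ∃ τ' : TopologicalSpace F, IsLocallyConvexHausdorff 𝕜 τ' ∧
        SatisfiesBBC 𝕜 τ τ' ∧ SatisfiesCNC 𝕜 τ τ' ∧
        ∃ hδ : ∀ x : Ω, pointEvaluation F x ∈ boundedlyContinuousDual 𝕜 τ τ',
          @Continuous Ω (boundedlyContinuousDual 𝕜 τ τ') _ (boundedlyContinuousDualTopology 𝕜 τ τ')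
            (fun x => ⟨pointEvaluation F x, hδ x⟩)) ∧
    -- (d) ⇒ (c) on `gk_ℝ`-spaces
    (IsGkRSpace.{u, w'} Ω →
      (∃ τ' : TopologicalSpace F, IsLocallyConvexHausdorff 𝕜 τ' ∧
        SatisfiesBBC 𝕜 τ τ' ∧ SatisfiesCNC 𝕜 τ τ' ∧ τ' ≤ compactOpenTopology F) →
      ∃ τ' : TopologicalSpace F, IsLocallyConvexHausdorff 𝕜 τ' ∧
        SatisfiesBBC 𝕜 τ τ' ∧ SatisfiesCNC 𝕜 τ τ' ∧
        ∃ hδ : ∀ x : Ω, pointEvaluation F x ∈ boundedlyContinuousDual 𝕜 τ τ',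
          @Continuous Ω (boundedlyContinuousDual 𝕜 τ τ') _ (boundedlyContinuousDualTopology 𝕜 τ τ')
            (fun x => ⟨pointEvaluation F x, hδ x⟩)) := by

  refine ⟨⟨exists_bbc_cnc_of_admitsLinearisation, ?_⟩, ⟨fun h => ?_, ?_⟩, ?_⟩
  · rintro ⟨⟨τ', hτ', hBBC, hCNC, hle⟩, heq⟩
    obtain ⟨hδ, hcont⟩ := exists_continuous_pointEvaluation_of_equicontinuous hle heq
    exact admitsLinearisation_of_continuous_pointEvaluation hτ hborn hτ' hBBC hCNC hδ hcont
  · obtain ⟨⟨τ', hτ', hBBC, hCNC, hle⟩, heq⟩ := exists_bbc_cnc_of_admitsLinearisation h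
    exact ⟨τ', hτ', hBBC, hCNC, exists_continuous_pointEvaluation_of_equicontinuous hle heq⟩
  · rintro ⟨τ', hτ', hBBC, hCNC, hδ, hcont⟩
    exact admitsLinearisation_of_continuous_pointEvaluation hτ hborn hτ' hBBC hCNC hδ hcont
  · rintro hΩ ⟨τ', hτ', hBBC, hCNC, hle⟩
    exact ⟨τ', hτ', hBBC, hCNC, hΩ.exists_continuous_pointEvaluation hF hBBC hle⟩
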